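/- Conventions. Algebras are not assumed to be unital. A JB-algebra is a real Jordan algebra with a complete norm such that $\|a\circ b\|\le\|a\|\|b\|$, $\|a^2\|=\|a\|^2$ and $\|a^2\|\le\|a^2+b^2\|$. A locally JB-algebra (respectively a locally C*-algebra) is a topological real Jordan algebra (respectively a topological complex *-algebra) that is topologically isomorphic (respectively topologically *-isomorphic) to the projective limit of a projective family of JB-algebras with Jordan homomorphisms (respectively of C*-algebras with *-homomorphisms) over a directed set, with the topology induced by the product of the norm topologies. For a locally C*-algebra $\mathfrak A$, the self-adjoint part $\mathfrak A_{sa}$ carries the Jordan product $x\circ y=\tfrac12(xy+yx)$. Jordan homomorphisms from a locally JB-algebra to $\mathfrak A_{sa}$ (real-linear maps that preserve $\circ$), *-homomorphisms and *-antiautomorphisms of locally C*-algebras are understood to be continuous. Theorem. For every locally JB-algebra $A$ there exist a locally C*-algebra $LC^*_u(A)$ (the universal enveloping locally C*-algebra of $A$) and a Jordan homomorphism $\psi_A:A\to LC^*_u(A)_{sa}$ such that: 1) $\psi_A(A)$ generates $LC^*_u(A)$ as a locally C*-algebra, i.e. the smallest closed *-subalgebra of $LC^*_u(A)$ that contains $\psi_A(A)$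 is $LC^*_u(A)$; 2) for every locally C*-algebra $\mathfrak A$ and every Jordan homomorphism $\varphi:A\to\mathfrak A_{sa}$ there exists a *-homomorphism $\widehat\varphi:LC^*_u(A)\to\mathfrak A$ such that $\varphi=\widehat\varphi\circ\psi_A$; 3) there exists a *-antiautomorphism $\Phi$ of $LC^*_u(A)$ with $\Phi\circ\Phi=\mathrm{id}$ such that $\Phi(\psi_A(a))=\psi_A(a)$ for all $a\in A$. The pair $(LC^*_u(A),\psi_A)$ is unique up to topological *-isomorphism: if a locally C*-algebra $L'$ and a Jordan homomorphism $\psi':A\to L'_{sa}$ satisfy 1) and 2), then there is a topological *-isomorphism $e:LC^*_u(A)\to L'$ with $e\circ\psi_A=\psi'$. -/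

import Mathlib

universe u v w

/-! ### JB-algebras and locally JB-algebras -/

/-- A JB-algebra (not necessarily unital): a real Jordan algebra with a complete norm such that
`‖a ∘ b‖ ≤ ‖a‖ ‖b‖`, `‖a²‖ = ‖a‖²` and `‖a²‖ ≤ ‖a² + b²‖`. The Jordan product is written `*`. -/
class JBAlgebra (A : Type u) extends NormedAddCommGroup A, NonUnitalNonAssocCommRing A,
    NormedSpace ℝ A, IsScalarTower ℝ A A, SMulCommClass ℝ A A, IsCommJordan A,
    CompleteSpace A where
  norm_mul_le' : ∀ a b : A, ‖a * b‖ ≤ ‖a‖ * ‖b‖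
  norm_mul_self' : ∀ a : A, ‖a * a‖ = ‖a‖ ^ 2
  norm_mul_self_le' : ∀ a b : A, ‖a * a‖ ≤ ‖a * a + b * b‖

/-- A projective family of JB-algebras: connecting Jordan homomorphisms `A_β → A_α` for
`α ≤ β`, compatible with composition. (Jordan homomorphisms of JB-algebras are automatically
continuous.) -/
structure JBProjectiveFamily (Λ : Type u) [Preorder Λ] where
  obj : Λ → Type u
  [inst : ∀ α, JBAlgebra (obj α)]
  map : ∀ {α β : Λ}, α ≤ β → (obj β →ₙₐ[ℝ] obj α)
  map_refl : ∀ (α : Λ) (x : obj α), map (le_refl α) x = x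
  map_trans : ∀ {α β γ : Λ} (h : α ≤ β) (k : β ≤ γ) (x : obj γ),
    map h (map k x) = map (h.trans k) x

attribute [instance] JBProjectiveFamily.inst

/-- The projective limit of a projective family of JB-algebras: the subalgebra of compatible
threads in the product. It carries the topology induced by the product topology. -/
def JBProjectiveFamily.limit {Λ : Type u} [Preorder Λ] (F : JBProjectiveFamily Λ) :
    NonUnitalSubalgebra ℝ (∀ α, F.obj α) where
  carrier := {x | ∀ (α β : Λ) (h : α ≤ β), F.map h (x β) = x α}
  zero_mem' := by intro α β h; simp
  add_mem' := by intro x y hx hy α β h; simp [hx α β h, hy α β h]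
  mul_mem' := by intro x y hx hy α β h; simp [hx α β h, hy α β h]
  smul_mem' := by intro c x hx α β h; simp [hx α β h]

/-- A locally JB-algebra: a real Jordan algebra with a topology which is topologically
isomorphic to the projective limit of a projective family of JB-algebras over a directed set. -/
class LocallyJBAlgebra (A : Type u) extends NonUnitalNonAssocCommRing A, Module ℝ A,
    IsScalarTower ℝ A A, SMulCommClass ℝ A A, IsCommJordan A, TopologicalSpace A where
  exists_limit : ∃ (Λ : Type u) (_ : Preorder Λ) (_ : Nonempty Λ) (_ : IsDirectedOrder Λ)
    (F : JBProjectiveFamily Λ) (e : A ≃L[ℝ] F.limit), ∀ a b : A, e (a * b) = e a * e b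

/-! ### Locally C*-algebras -/

/-- A projective family of (not necessarily unital) C*-algebras: connecting *-homomorphisms
`𝔄_β → 𝔄_α` for `α ≤ β`, compatible with composition. (*-homomorphisms of C*-algebras are
automatically continuous.) -/
structure CStarProjectiveFamily (Λ : Type u) [Preorder Λ] where
  obj : Λ → Type u
  [inst : ∀ α, NonUnitalCStarAlgebra (obj α)]
  map : ∀ {α β : Λ}, α ≤ β → (obj β →⋆ₙₐ[ℂ] obj α)
  map_refl : ∀ (α : Λ) (x : obj α), map (le_refl α) x = x
  map_trans : ∀ {α β γ : Λ} (h : α ≤ β) (k : β ≤ γ) (x : obj γ),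
    map h (map k x) = map (h.trans k) x

attribute [instance] CStarProjectiveFamily.inst

/-- The projective limit of a projective family of C*-algebras: the *-subalgebra of compatible
threads in the product. It carries the topology induced by the product topology. -/
def CStarProjectiveFamily.limit {Λ : Type u} [Preorder Λ] (F : CStarProjectiveFamily Λ) :
    NonUnitalStarSubalgebra ℂ (∀ α, F.obj α) where
  carrier := {x | ∀ (α β : Λ) (h : α ≤ β), F.map h (x β) = x α}
  zero_mem' := by intro α β h; simp
  add_mem' := by intro x y hx hy α β h; simp [hx α β h, hy α β h]
  mul_mem' := by intro x y hx hy α β h; simp [hx α β h, hy α β h]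
  smul_mem' := by intro c x hx α β h; simp [hx α β h]
  star_mem' := by intro x hx α β h; simp [map_star, hx α β h]

/-- A locally C*-algebra: a complex *-algebra with a topology which is topologically
*-isomorphic to the projective limit of a projective family of C*-algebras over a directed
set. -/
class LocallyCStarAlgebra (L : Type u) extends NonUnitalRing L, StarRing L, Module ℂ L,
    IsScalarTower ℂ L L, SMulCommClass ℂ L L, StarModule ℂ L, TopologicalSpace L where
  exists_limit : ∃ (Λ : Type u) (_ : Preorder Λ) (_ : Nonempty Λ) (_ : IsDirectedOrder Λ)
    (F : CStarProjectiveFamily Λ) (e : L ≃⋆ₐ[ℂ] F.limit), Continuous e ∧ Continuous e.symm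

/-! ### Jordan homomorphisms and universal enveloping algebras -/

/-- A Jordan homomorphism from a locally JB-algebra `A` into the self-adjoint part of a locally
C*-algebra `L`: a continuous real-linear map with self-adjoint values that takes the product of
`A` to the Jordan product `(x y + y x) / 2`. -/
structure JordanHom (A : Type u) (L : Type w) [LocallyJBAlgebra A] [LocallyCStarAlgebra L]
    extends A →L[ℝ] L where
  isSelfAdjoint' : ∀ a : A, IsSelfAdjoint (toContinuousLinearMap a)
  map_jordan' : ∀ a b : A,
    toContinuousLinearMap (a * b) = (1 / 2 : ℝ) •
      (toContinuousLinearMap a * toContinuousLinearMap b +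
        toContinuousLinearMap b * toContinuousLinearMap a)

instance (A : Type u) (L : Type w) [LocallyJBAlgebra A] [LocallyCStarAlgebra L] :
    CoeFun (JordanHom A L) (fun _ => A → L) where
  coe ψ := ψ.toContinuousLinearMap

/-- `ψ : A → L_sa` makes `L` a universal enveloping locally C*-algebra of `A`, the universal
property being tested on locally C*-algebras in `Type v`. -/
structure IsUniversalEnveloping {A : Type u} {L : Type w} [LocallyJBAlgebra A]
    [LocallyCStarAlgebra L] (ψ : JordanHom A L) : Prop where
  /-- The smallest closed *-subalgebra of `L` containing `ψ(A)` is `L`. -/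
  generates : ∀ S : NonUnitalStarSubalgebra ℂ L,
    IsClosed (S : Set L) → Set.range ψ ⊆ (S : Set L) → S = ⊤
  /-- Jordan homomorphisms into locally C*-algebras factor through `ψ`. -/
  factors : ∀ (B : Type v) [LocallyCStarAlgebra B] (φ : JordanHom A B),
    ∃ φ' : L →⋆ₙₐ[ℂ] B, Continuous φ' ∧ ∀ a : A, φ a = φ' (ψ a)

/-- A *-antiautomorphism `Φ` of a locally C*-algebra with `Φ ∘ Φ = id`: an involutive
topological linear isomorphism that reverses products and commutes with the involution. -/
structure IsStarAntiautomorphismOfOrderTwo {L : Type w} [LocallyCStarAlgebra L]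
    (Φ : L ≃L[ℂ] L) : Prop where
  map_mul : ∀ x y : L, Φ (x * y) = Φ y * Φ x
  map_star : ∀ x : L, Φ (star x) = star (Φ x)
  involutive : ∀ x : L, Φ (Φ x) = x

/-! ### Transport of C*-structures -/

/-! The universal algebra is the projective limit of all C*-algebras generated by a Jordan image of
`A`, ordered by the quotient relation. They form a set up to isomorphism: every point of such an
algebra is a limit of a sequence of star polynomials in `A`, so the algebra can be rebuilt on a
subset of `ℕ → StarTerm A` (`IsJordanMap.exists_envelope`). The order is directed because two Jordan
maps combine into one map to the product. By directedness a basic neighbourhood in the limit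
involves a single coordinate, so `A` generates the limit because it generates each coordinate
(`limit_generates`). A Jordan map into a projective limit of C*-algebras is lifted coordinate by
coordinate (`exists_lift`). Throughout, continuous *-homomorphisms into a Hausdorff algebra that
agree on generators are equal (`eq_of_generates`). This gives compatibility of the lifts, uniqueness
of the pair, and `Φ ∘ Φ = id` for the lift `Φ` of the map into the opposite algebra. -/

theorem exists_nonUnitalCStarAlgebra_of_equiv {α : Type u} {B : Type v} [NonUnitalCStarAlgebra B]
    (e : α ≃ B) :
    ∃ (_ : NonUnitalCStarAlgebra α) (E : α ≃⋆ₐ[ℂ] B), ∀ x, E x = e x := by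
  let i1 : NonUnitalRing α := e.nonUnitalRing
  let i2 : Module ℂ α := e.module ℂ
  let i3 : Star α := ⟨fun x => e.symm (star (e x))⟩
  have hadd : ∀ x y : α, e (x + y) = e x + e y := fun x y => e.apply_symm_apply _
  have hmul : ∀ x y : α, e (x * y) = e x * e y := fun x y => e.apply_symm_apply _
  have hsmul : ∀ (c : ℂ) (x : α), e (c • x) = c • e x := fun c x => e.apply_symm_apply _
  have hzero : e (0 : α) = 0 := e.apply_symm_apply _
  have hstar : ∀ x : α, e (star x) = star (e x) := fun x => e.apply_symm_apply _
  let f : α →ₙ+* B :=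
    { toFun := e, map_mul' := hmul, map_zero' := hzero, map_add' := hadd }
  let i4 : NonUnitalNormedRing α := NonUnitalNormedRing.induced α B f e.injective
  have hnorm : ∀ x : α, ‖x‖ = ‖e x‖ := fun x => rfl
  have hiso : Isometry e := fun x y => rfl
  let i5 : StarRing α :=
    { star_involutive := fun x => e.injective (by rw [hstar, hstar, star_star])
      star_mul := fun x y => e.injective (by rw [hstar, hmul, hmul, hstar, hstar, star_mul])
      star_add := fun x y => e.injective (by rw [hstar, hadd, hadd, hstar, hstar, star_add]) }
  let i6 : NormedSpace ℂ α :=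
    { i2 with norm_smul_le := fun c x => by rw [hnorm, hsmul, norm_smul, hnorm] }
  have h7 : CompleteSpace α := by
    rw [completeSpace_iff_isComplete_range hiso.isUniformInducing, e.surjective.range_eq]
    exact isComplete_univ
  have h8 : CStarRing α :=
    ⟨fun x => by rw [hnorm, hnorm, hmul, hstar]; exact CStarRing.norm_mul_self_le (e x)⟩
  have h9 : IsScalarTower ℂ α α :=
    ⟨fun c x y => e.injective (by
      simp only [smul_eq_mul]; rw [hmul, hsmul, hsmul, hmul, smul_mul_assoc])⟩
  have h10 : SMulCommClass ℂ α α :=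
    ⟨fun c x y => e.injective (by
      simp only [smul_eq_mul]; rw [hmul, hsmul, hsmul, hmul, mul_smul_comm])⟩
  have h11 : StarModule ℂ α :=
    ⟨fun c x => e.injective (by rw [hstar, hsmul, hsmul, hstar, star_smul])⟩
  exact ⟨{ }, { e with
    map_mul' := hmul, map_add' := hadd, map_star' := hstar, map_smul' := hsmul }, fun _ => rfl⟩

theorem NonUnitalStarAlgHom.continuous_of_cstar {B : Type u} {C : Type v}
    [NonUnitalCStarAlgebra B] [NonUnitalCStarAlgebra C] (f : B →⋆ₙₐ[ℂ] C) : Continuous f :=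
  (NonUnitalStarAlgHom.instContinuousLinearMapClassComplex
    (F := B →⋆ₙₐ[ℂ] C) (A := B) (B := C)).map_continuous f

/-- A continuous star homomorphism is determined by its values on a generating set. -/
theorem NonUnitalStarAlgHom.eq_of_generates {ι L B : Type*} [NonUnitalRing L] [StarRing L]
    [Module ℂ L] [IsScalarTower ℂ L L] [SMulCommClass ℂ L L] [StarModule ℂ L]
    [TopologicalSpace L] [NonUnitalRing B] [StarRing B] [Module ℂ B]
    [TopologicalSpace B] [T2Space B] {ψ : ι → L}
    (hψ : ∀ S : NonUnitalStarSubalgebra ℂ L,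
      IsClosed (S : Set L) → Set.range ψ ⊆ (S : Set L) → S = ⊤)
    {f g : L →⋆ₙₐ[ℂ] B} (hf : Continuous f) (hg : Continuous g)
    (h : ∀ a, f (ψ a) = g (ψ a)) (x : L) : f x = g x := by
  have := hψ (NonUnitalStarAlgHom.equalizer f g) (isClosed_eq hf hg)
    (by rintro _ ⟨a, rfl⟩; exact h a)
  have hx : x ∈ NonUnitalStarAlgHom.equalizer f g := by rw [this]; trivial
  exact hx

/-! ### Jordan maps -/

/-- A continuous real-linear self-adjoint-valued map that sends the product of `A` to the Jordan
product, with real scalars acting through `ℂ`. -/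
structure IsJordanMap {A : Type u} {B : Type v} [LocallyJBAlgebra A] [NonUnitalRing B]
    [StarRing B] [Module ℂ B] [TopologicalSpace B] (f : A → B) : Prop where
  continuous : Continuous f
  map_add : ∀ a b, f (a + b) = f a + f b
  map_smul : ∀ (r : ℝ) a, f (r • a) = (r : ℂ) • f a
  isSelfAdjoint : ∀ a, IsSelfAdjoint (f a)
  map_mul : ∀ a b, f (a * b) = (1 / 2 : ℂ) • (f a * f b + f b * f a)

section IsJordanMap

variable {A : Type u} [LocallyJBAlgebra A]

theorem IsJordanMap.comp {B : Type v} {C : Type w} [NonUnitalRing B] [StarRing B] [Module ℂ B]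
    [TopologicalSpace B] [NonUnitalRing C] [StarRing C] [Module ℂ C] [TopologicalSpace C]
    {f : A → B} (hf : IsJordanMap f) (g : B →⋆ₙₐ[ℂ] C) (hg : Continuous g) :
    IsJordanMap (fun a => g (f a)) where
  continuous := hg.comp hf.continuous
  map_add a b := by rw [hf.map_add, _root_.map_add]
  map_smul r a := by rw [hf.map_smul, _root_.map_smul]
  isSelfAdjoint a := (hf.isSelfAdjoint a).map g
  map_mul a b := by
    rw [hf.map_mul, _root_.map_smul, _root_.map_add, _root_.map_mul, _root_.map_mul]

/-- Source of upper bounds in the order on envelopes. -/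
theorem IsJordanMap.prodMk {B : Type v} {C : Type w} [NonUnitalCStarAlgebra B]
    [NonUnitalCStarAlgebra C] {f : A → B} {g : A → C} (hf : IsJordanMap f) (hg : IsJordanMap g) :
    IsJordanMap (fun a => (f a, g a)) where
  continuous := hf.continuous.prodMk hg.continuous
  map_add a b := Prod.ext (hf.map_add a b) (hg.map_add a b)
  map_smul r a := Prod.ext (hf.map_smul r a) (hg.map_smul r a)
  isSelfAdjoint a := Prod.ext (hf.isSelfAdjoint a) (hg.isSelfAdjoint a)
  map_mul a b := Prod.ext (hf.map_mul a b) (hg.map_mul a b)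

/-- The Jordan product is symmetric in its factors, hence blind to reversal of multiplication. The
antiautomorphism comes from this. -/
theorem IsJordanMap.op {B : Type v} [NonUnitalRing B] [StarRing B] [Module ℂ B]
    [TopologicalSpace B] {f : A → B} (hf : IsJordanMap f) :
    IsJordanMap (fun a => MulOpposite.op (f a)) where
  continuous := MulOpposite.continuous_op.comp hf.continuous
  map_add a b := by rw [hf.map_add, MulOpposite.op_add]
  map_smul r a := by rw [hf.map_smul, MulOpposite.op_smul]
  isSelfAdjoint a := congrArg MulOpposite.op (hf.isSelfAdjoint a)
  map_mul a b := by
    rw [hf.map_mul, MulOpposite.op_smul, MulOpposite.op_add, MulOpposite.op_mul,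
      MulOpposite.op_mul, add_comm]

theorem JordanHom.isJordanMap {L : Type v} [LocallyCStarAlgebra L] (φ : JordanHom A L) :
    IsJordanMap φ where
  continuous := φ.continuous
  map_add := _root_.map_add φ.toContinuousLinearMap
  map_smul r a := by rw [_root_.map_smul, Complex.coe_smul]
  isSelfAdjoint := φ.isSelfAdjoint'
  map_mul a b := by
    rw [φ.map_jordan', ← Complex.coe_smul]; norm_num

/-- The Jordan homomorphism given by a Jordan map. -/
def IsJordanMap.toJordanHom {L : Type v} [LocallyCStarAlgebra L] {f : A → L}
    (hf : IsJordanMap f) : JordanHom A L where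
  toFun := f
  map_add' := hf.map_add
  map_smul' r a := by rw [hf.map_smul, Complex.coe_smul]; rfl
  cont := hf.continuous
  isSelfAdjoint' := hf.isSelfAdjoint
  map_jordan' a b := by
    refine (hf.map_mul a b).trans ?_
    rw [← Complex.coe_smul]; norm_num

end IsJordanMap

/-! ### Small generated subalgebras -/

/-- Formal star polynomials in elements of `A`, without constant term. -/
inductive StarTerm (A : Type u) : Type u
  | zero : StarTerm A
  | of (a : A) : StarTerm A
  | add (s t : StarTerm A) : StarTerm A
  | mul (s t : StarTerm A) : StarTerm A
  | smul (c : ℂ) (s : StarTerm A) : StarTerm A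
  | star (s : StarTerm A) : StarTerm A

/-- Evaluation of a formal star polynomial. -/
def StarTerm.eval {A : Type u} {B : Type v} [NonUnitalRing B] [StarRing B] [Module ℂ B]
    (f : A → B) : StarTerm A → B
  | zero => 0
  | of a => f a
  | add s t => s.eval f + t.eval f
  | mul s t => s.eval f * t.eval f
  | smul c s => c • s.eval f
  | star s => Star.star (s.eval f)

/-- The values of the formal star polynomials at `f`. -/
def StarTerm.range {A : Type u} {B : Type v} [NonUnitalRing B] [StarRing B] [Module ℂ B]
    (f : A → B) : NonUnitalStarSubalgebra ℂ B where
  carrier := Set.range (StarTerm.eval f)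
  zero_mem' := ⟨.zero, rfl⟩
  add_mem' := by rintro _ _ ⟨s, rfl⟩ ⟨t, rfl⟩; exact ⟨s.add t, rfl⟩
  mul_mem' := by rintro _ _ ⟨s, rfl⟩ ⟨t, rfl⟩; exact ⟨s.mul t, rfl⟩
  smul_mem' := by rintro c _ ⟨s, rfl⟩; exact ⟨s.smul c, rfl⟩
  star_mem' := by rintro _ ⟨s, rfl⟩; exact ⟨s.star, rfl⟩

/-- Choose for each point a sequence of star polynomials whose values converge to it; uniqueness of
limits makes the choice injective. The bound lies in `Type u`, whatever the universe of `C`. -/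
theorem exists_injective_of_generates {A : Type u} {C : Type v} [NonUnitalCStarAlgebra C]
    {f : A → C}
    (hf : ∀ S : NonUnitalStarSubalgebra ℂ C,
      IsClosed (S : Set C) → Set.range f ⊆ (S : Set C) → S = ⊤) :
    ∃ j : C → (ℕ → StarTerm A), Function.Injective j := by
  have htop := hf (StarTerm.range f).topologicalClosure
    (NonUnitalStarSubalgebra.isClosed_topologicalClosure _)
    (by rintro _ ⟨a, rfl⟩; exact subset_closure ⟨.of a, rfl⟩)
  have hx : ∀ x : C, ∃ s : ℕ → StarTerm A,
      Filter.Tendsto (fun n => (s n).eval f) Filter.atTop (nhds x) := by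
    intro x
    have h : x ∈ closure (Set.range (StarTerm.eval f)) := by
      have : x ∈ (StarTerm.range f).topologicalClosure := by rw [htop]; trivial
      exact this
    obtain ⟨y, hy, hlim⟩ := mem_closure_iff_seq_limit.1 h
    choose s hs using hy
    exact ⟨s, by simpa only [hs] using hlim⟩
  choose j hj using hx
  exact ⟨j, fun x y hxy => tendsto_nhds_unique (hj x) (hxy ▸ hj y)⟩

/-- A C*-algebra, on a set of sequences of formal star polynomials, generated by the image of a
Jordan map from `A`. -/
structure JordanEnvelope (A : Type u) [LocallyJBAlgebra A] : Type u where
  carrier : Set (ℕ → StarTerm A)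
  [inst : NonUnitalCStarAlgebra carrier]
  toFun : A → carrier
  isJordanMap : IsJordanMap toFun
  generates : ∀ S : NonUnitalStarSubalgebra ℂ carrier,
    IsClosed (S : Set carrier) → Set.range toFun ⊆ (S : Set carrier) → S = ⊤

attribute [instance] JordanEnvelope.inst

/-- Every Jordan map into a C*-algebra factors through a `JordanEnvelope`. -/
theorem IsJordanMap.exists_envelope {A : Type u} [LocallyJBAlgebra A] {B : Type v}
    [NonUnitalCStarAlgebra B] {f : A → B} (hf : IsJordanMap f) :
    ∃ (i : JordanEnvelope A) (h : i.carrier →⋆ₙₐ[ℂ] B), ∀ a, h (i.toFun a) = f a := by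
  let D : NonUnitalStarSubalgebra ℂ B := (StarTerm.range f).topologicalClosure
  have hD : IsClosed (D : Set B) := NonUnitalStarSubalgebra.isClosed_topologicalClosure _
  let g : A → D := fun a => ⟨f a, subset_closure ⟨.of a, rfl⟩⟩
  have hg : IsJordanMap g :=
    { continuous := hf.continuous.subtype_mk _
      map_add := fun a b => Subtype.ext (hf.map_add a b)
      map_smul := fun r a => Subtype.ext (hf.map_smul r a)
      isSelfAdjoint := fun a => Subtype.ext (hf.isSelfAdjoint a)
      map_mul := fun a b => Subtype.ext (hf.map_mul a b) }
  let ι : D →⋆ₙₐ[ℂ] B := NonUnitalStarSubalgebraClass.subtype D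
  have hgen : ∀ S : NonUnitalStarSubalgebra ℂ D,
      IsClosed (S : Set D) → Set.range g ⊆ (S : Set D) → S = ⊤ := by
    intro S hS hgS
    -- `D` is closed in `B`, so the image of `S` is closed in `B`; it therefore suffices that it
    -- contains the star polynomials in `f`.
    have hle : D ≤ S.map ι := by
      refine NonUnitalStarSubalgebra.topologicalClosure_minimal _ ?_
        (hD.isClosedMap_subtype_val _ hS)
      rintro _ ⟨t, rfl⟩
      induction t with
      | zero => exact zero_mem _
      | of a => exact ⟨g a, hgS ⟨a, rfl⟩, rfl⟩
      | add s t hs ht => exact add_mem hs ht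
      | mul s t hs ht => exact mul_mem hs ht
      | smul c s hs => exact SMulMemClass.smul_mem c hs
      | star s hs => exact star_mem hs
    refine eq_top_iff.2 fun x _ => ?_
    obtain ⟨y, hy, hyx⟩ := hle x.2
    rwa [← Subtype.ext (show (y : B) = x from hyx)]
  obtain ⟨j, hj⟩ := exists_injective_of_generates hgen
  -- Moves `D` from `Type v` onto a set of sequences in `Type u`.
  obtain ⟨_, E, -⟩ := exists_nonUnitalCStarAlgebra_of_equiv (Equiv.ofInjective j hj).symm
  have hE : Continuous E := (StarAlgEquiv.isometry E).continuous
  have hE' : Continuous E.symm := (StarAlgEquiv.isometry E.symm).continuous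
  refine ⟨⟨Set.range j, fun a => E.symm (g a),
    hg.comp (E.symm : D →⋆ₙₐ[ℂ] Set.range j) hE', fun S hS hgS => ?_⟩,
    ι.comp (E : Set.range j →⋆ₙₐ[ℂ] D), fun a => ?_⟩
  · have := hgen (S.comap (E.symm : D →⋆ₙₐ[ℂ] Set.range j)) (hS.preimage hE')
      (by rintro _ ⟨a, rfl⟩; exact hgS ⟨a, rfl⟩)
    refine eq_top_iff.2 fun x _ => ?_
    have hx : E x ∈ S.comap (E.symm : D →⋆ₙₐ[ℂ] Set.range j) := by rw [this]; trivial
    have hx' : E.symm (E x) ∈ S := hx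
    rwa [E.symm_apply_apply] at hx'
  · exact congrArg Subtype.val (E.apply_symm_apply (g a))

/-! ### Projective limits of C*-algebras -/

namespace CStarProjectiveFamily

variable {Λ : Type u} [Preorder Λ] (F : CStarProjectiveFamily Λ)

/-- The projection of the projective limit to a member of the family. -/
def proj (α : Λ) : F.limit →⋆ₙₐ[ℂ] F.obj α where
  toFun x := x.1 α
  map_smul' _ _ := rfl
  map_zero' := rfl
  map_add' _ _ := rfl
  map_mul' _ _ := rfl
  map_star' _ := rfl

theorem continuous_proj (α : Λ) : Continuous (F.proj α) :=
  (continuous_apply α).comp continuous_subtype_val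

theorem map_proj {α β : Λ} (h : α ≤ β) (x : F.limit) : F.map h (F.proj β x) = F.proj α x :=
  x.2 α β h



/-- Projective limits of C*-algebras over directed sets are locally C*-algebras. -/
noncomputable abbrev locallyCStarAlgebra [Nonempty Λ] [IsDirectedOrder Λ] :
    LocallyCStarAlgebra F.limit where
  exists_limit := ⟨Λ, inferInstance, inferInstance, inferInstance, F, StarAlgEquiv.refl _ _,
    continuous_id, continuous_id⟩

/-- The finitely many coordinates restricted by a basic neighbourhood have an upper bound `γ`, and
their conditions pull back to `γ` along the continuous connecting maps. -/
theorem exists_proj_preimage_subset [Nonempty Λ] [IsDirectedOrder Λ] {x : F.limit}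
    {t : Set F.limit} (ht : t ∈ nhds x) :
    ∃ (γ : Λ), ∃ V ∈ nhds (F.proj γ x), ∀ y, F.proj γ y ∈ V → y ∈ t := by
  obtain ⟨U, hU, hUt⟩ := mem_nhds_subtype _ _ _ |>.1 ht
  rw [nhds_pi, Filter.mem_pi] at hU
  obtain ⟨I, hI, s, hs, hIs⟩ := hU
  obtain ⟨γ, hγ⟩ := hI.toFinset.exists_le
  have hγ' : ∀ α ∈ I, α ≤ γ := fun α hα => hγ α (hI.mem_toFinset.2 hα)
  refine ⟨γ, ⋂ α ∈ I, {z | ∀ h : α ≤ γ, F.map h z ∈ s α}, ?_, fun y hy => hUt (hIs fun α hα => ?_)⟩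
  · refine (Filter.biInter_mem hI).2 fun α hα => ?_
    have hc := (F.map (hγ' α hα)).continuous_of_cstar.tendsto (F.proj γ x)
    rw [F.map_proj] at hc
    exact Filter.mem_of_superset (hc (hs α)) fun z hz _ => hz
  · have := Set.mem_iInter₂.1 hy α hα (hγ' α hα)
    rwa [F.map_proj] at this

/-- A subset of a projective limit that generates every member of the family generates the
projective limit. -/
theorem limit_generates [Nonempty Λ] [IsDirectedOrder Λ] {ι : Type*} {ψ : ι → F.limit}
    (h : ∀ (α : Λ) (S : NonUnitalStarSubalgebra ℂ (F.obj α)), IsClosed (S : Set (F.obj α)) →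
      Set.range (fun a => F.proj α (ψ a)) ⊆ (S : Set (F.obj α)) → S = ⊤)
    (S : NonUnitalStarSubalgebra ℂ F.limit) (hS : IsClosed (S : Set F.limit))
    (hψ : Set.range ψ ⊆ (S : Set F.limit)) : S = ⊤ := by
  refine eq_top_iff.2 fun x _ => ?_
  suffices x ∈ closure (S : Set F.limit) by rwa [hS.closure_eq] at this
  refine mem_closure_iff_nhds.2 fun t ht => ?_
  obtain ⟨γ, V, hV, hVt⟩ := F.exists_proj_preimage_subset ht
  -- The image of `S` is dense in coordinate `γ`, since its closure contains the generators there.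
  have htop := h γ (S.map (F.proj γ)).topologicalClosure
    (NonUnitalStarSubalgebra.isClosed_topologicalClosure _)
    (by rintro _ ⟨a, rfl⟩; exact subset_closure ⟨ψ a, hψ ⟨a, rfl⟩, rfl⟩)
  have hx : F.proj γ x ∈ closure (F.proj γ '' S) := by
    have : F.proj γ x ∈ (S.map (F.proj γ)).topologicalClosure := by rw [htop]; trivial
    exact this
  obtain ⟨_, hyV, y, hyS, rfl⟩ := mem_closure_iff_nhds.1 hx V hV
  exact ⟨y, hVt y hyV, hyS⟩

/-- The family of opposite C*-algebras. -/
noncomputable def op : CStarProjectiveFamily Λ where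
  obj α := (F.obj α)ᵐᵒᵖ
  map h :=
    { toFun := fun x => MulOpposite.op (F.map h x.unop)
      map_smul' := fun c x => by simp
      map_zero' := by simp
      map_add' := fun x y => by simp
      map_mul' := fun x y => by simp
      map_star' := fun x => by simp [map_star] }
  map_refl α x := congrArg MulOpposite.op (F.map_refl α x.unop)
  map_trans h k x := congrArg MulOpposite.op (F.map_trans h k x.unop)

end CStarProjectiveFamily

instance LocallyCStarAlgebra.t2Space {L : Type u} [LocallyCStarAlgebra L] : T2Space L := by
  obtain ⟨Λ, _, _, _, F, e, he, -⟩ := LocallyCStarAlgebra.exists_limit (L := L)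
  exact T2Space.of_injective_continuous e.injective he

noncomputable instance LocallyCStarAlgebra.mulOpposite {L : Type u} [LocallyCStarAlgebra L] :
    LocallyCStarAlgebra Lᵐᵒᵖ where
  exists_limit := by
    obtain ⟨Λ, _, h1, h2, F, e, he, he'⟩ := LocallyCStarAlgebra.exists_limit (L := L)
    refine ⟨Λ, inferInstance, h1, h2, F.op,
      { toFun := fun x => ⟨fun α => MulOpposite.op ((e x.unop).1 α),
          fun α β h => congrArg MulOpposite.op ((e x.unop).2 α β h)⟩
        invFun := fun y => MulOpposite.op (e.symm ⟨fun α => (y.1 α).unop,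
          fun α β h => congrArg MulOpposite.unop (y.2 α β h)⟩)
        left_inv := fun x => congrArg MulOpposite.op (e.symm_apply_apply x.unop)
        right_inv := fun y => ?_
        map_mul' := fun x y => ?_
        map_add' := fun x y => ?_
        map_star' := fun x => ?_
        map_smul' := fun c x => ?_ }, ?_, ?_⟩
    · refine Subtype.ext (funext fun α => ?_)
      simp only [MulOpposite.unop_op, StarAlgEquiv.apply_symm_apply]
      rfl
    · refine Subtype.ext (funext fun α => ?_)
      simp only [MulOpposite.unop_mul, map_mul]
      rfl
    · refine Subtype.ext (funext fun α => ?_)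
      simp only [MulOpposite.unop_add, map_add]
      rfl
    · refine Subtype.ext (funext fun α => ?_)
      simp only [MulOpposite.unop_star, map_star]
      rfl
    · refine Subtype.ext (funext fun α => ?_)
      simp only [MulOpposite.unop_smul, map_smul]
      rfl
    · exact Continuous.subtype_mk (continuous_pi fun α => MulOpposite.continuous_op.comp
        ((F.continuous_proj α).comp (he.comp MulOpposite.continuous_unop))) _
    · exact MulOpposite.continuous_op.comp (he'.comp (Continuous.subtype_mk (continuous_pi fun α =>
        MulOpposite.continuous_unop.comp (F.op.continuous_proj α)) _))

/-! ### The universal enveloping algebra -/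

namespace JordanEnvelope

variable {A : Type u} [LocallyJBAlgebra A]

/-- `i ≤ j` if `i` is a quotient of `j`. -/
instance : Preorder (JordanEnvelope A) where
  le i j := ∃ h : j.carrier →⋆ₙₐ[ℂ] i.carrier, ∀ a, h (j.toFun a) = i.toFun a
  le_refl i := ⟨NonUnitalStarAlgHom.id ℂ i.carrier, fun _ => rfl⟩
  le_trans i j k := fun ⟨h, hh⟩ ⟨g, hg⟩ => ⟨h.comp g, fun a => by
    rw [NonUnitalStarAlgHom.comp_apply, hg, hh]⟩

/-- The quotient map that witnesses `i ≤ j`. -/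
noncomputable def connect {i j : JordanEnvelope A} (h : i ≤ j) : j.carrier →⋆ₙₐ[ℂ] i.carrier :=
  Classical.choose h

theorem connect_toFun {i j : JordanEnvelope A} (h : i ≤ j) (a : A) :
    connect h (j.toFun a) = i.toFun a :=
  Classical.choose_spec h a

/-- Makes the connecting maps, obtained by choice, independent of that choice and hence compatible
with composition. -/
theorem hom_ext (i : JordanEnvelope A) {B : Type v} [NonUnitalCStarAlgebra B]
    {f g : i.carrier →⋆ₙₐ[ℂ] B} (h : ∀ a, f (i.toFun a) = g (i.toFun a)) (x : i.carrier) :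
    f x = g x :=
  NonUnitalStarAlgHom.eq_of_generates i.generates f.continuous_of_cstar g.continuous_of_cstar h x

variable (A) in
/-- The projective family of all C*-algebras generated by Jordan images of `A`. -/
noncomputable def family : CStarProjectiveFamily (JordanEnvelope A) where
  obj i := i.carrier
  map h := connect h
  map_refl i x := i.hom_ext (f := connect (le_refl i)) (g := NonUnitalStarAlgHom.id ℂ i.carrier)
    (fun a => connect_toFun _ a) x
  map_trans {i j k} h g x := k.hom_ext (f := (connect h).comp (connect g))
    (g := connect (h.trans g))
    (fun a => by rw [NonUnitalStarAlgHom.comp_apply]; simp only [connect_toFun]) x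

instance : Nonempty (JordanEnvelope A) := by
  have : IsJordanMap (fun _ : A => (0 : ℂ)) :=
    { continuous := continuous_const
      map_add := by simp
      map_smul := by simp
      isSelfAdjoint := fun _ => IsSelfAdjoint.zero ℂ
      map_mul := by simp }
  exact ⟨this.exists_envelope.choose⟩

instance : IsDirectedOrder (JordanEnvelope A) where
  directed i j := by
    -- The subalgebra generated by the paired map in the product has both `i` and `j` as quotients.
    obtain ⟨k, h, hh⟩ := (i.isJordanMap.prodMk j.isJordanMap).exists_envelope
    exact ⟨k, ⟨(NonUnitalStarAlgHom.fst ℂ _ _).comp h, fun a => congrArg Prod.fst (hh a)⟩,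
      ⟨(NonUnitalStarAlgHom.snd ℂ _ _).comp h, fun a => congrArg Prod.snd (hh a)⟩⟩

/-- The canonical map from `A` to the projective limit of its enveloping C*-algebras. -/
noncomputable def toLimit (a : A) : (family A).limit :=
  ⟨fun i => i.toFun a, fun _ _ h => connect_toFun h a⟩

theorem isJordanMap_toLimit : IsJordanMap (toLimit (A := A)) where
  continuous := Continuous.subtype_mk (continuous_pi fun i => i.isJordanMap.continuous) _
  map_add a b := Subtype.ext (funext fun i => i.isJordanMap.map_add a b)
  map_smul r a := Subtype.ext (funext fun i => i.isJordanMap.map_smul r a)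
  isSelfAdjoint a := Subtype.ext (funext fun i => i.isJordanMap.isSelfAdjoint a)
  map_mul a b := Subtype.ext (funext fun i => i.isJordanMap.map_mul a b)

theorem toLimit_generates (S : NonUnitalStarSubalgebra ℂ (family A).limit)
    (hS : IsClosed (S : Set (family A).limit))
    (h : Set.range toLimit ⊆ (S : Set (family A).limit)) : S = ⊤ :=
  (family A).limit_generates (fun i T hT hψ => i.generates T hT hψ) S hS h

theorem exists_lift {B : Type v} [LocallyCStarAlgebra B] {f : A → B} (hf : IsJordanMap f) :
    ∃ g : (family A).limit →⋆ₙₐ[ℂ] B, Continuous g ∧ ∀ a, f a = g (toLimit a) := by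
  obtain ⟨Λ, _, _, _, G, e, he, he'⟩ := LocallyCStarAlgebra.exists_limit (L := B)
  have hj : ∀ α, IsJordanMap (fun a => G.proj α (e (f a))) := fun α =>
    hf.comp ((G.proj α).comp (e : B →⋆ₙₐ[ℂ] G.limit)) ((G.continuous_proj α).comp he)
  -- The envelopes are chosen independently for each `α`; that the resulting coordinates form a
  -- thread is checked on generators only.
  choose i h hh using fun α => (hj α).exists_envelope
  let k : ∀ α, (family A).limit →⋆ₙₐ[ℂ] G.obj α := fun α => (h α).comp ((family A).proj (i α))
  have hk : ∀ α, Continuous (k α) := fun α =>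
    (h α).continuous_of_cstar.comp ((family A).continuous_proj (i α))
  have hka : ∀ α a, k α (toLimit a) = G.proj α (e (f a)) := hh
  let m : (family A).limit →⋆ₙₐ[ℂ] G.limit :=
    { toFun := fun x => ⟨fun α => k α x, fun α β hαβ =>
        NonUnitalStarAlgHom.eq_of_generates toLimit_generates (f := (G.map hαβ).comp (k β))
          (g := k α) ((G.map hαβ).continuous_of_cstar.comp (hk β)) (hk α)
          (fun a => by
            rw [NonUnitalStarAlgHom.comp_apply, hka, hka, G.map_proj]) x⟩
      map_smul' := fun c x => Subtype.ext (funext fun α => map_smul (k α) c x)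
      map_zero' := Subtype.ext (funext fun α => map_zero (k α))
      map_add' := fun x y => Subtype.ext (funext fun α => map_add (k α) x y)
      map_mul' := fun x y => Subtype.ext (funext fun α => map_mul (k α) x y)
      map_star' := fun x => Subtype.ext (funext fun α => map_star (k α) x) }
  have hm : Continuous m := Continuous.subtype_mk (continuous_pi hk) _
  refine ⟨(e.symm : G.limit →⋆ₙₐ[ℂ] B).comp m, he'.comp hm, fun a => ?_⟩
  have : m (toLimit a) = e (f a) := Subtype.ext (funext fun α => hka α a)
  change f a = e.symm (m (toLimit a))
  rw [this, e.symm_apply_apply]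

noncomputable instance : LocallyCStarAlgebra (family A).limit := (family A).locallyCStarAlgebra

variable (A) in
/-- The canonical Jordan homomorphism from `A` to its universal enveloping algebra. -/
noncomputable def jordanHom : JordanHom A (family A).limit :=
  IsJordanMap.toJordanHom isJordanMap_toLimit

variable (A) in
theorem isUniversalEnveloping : IsUniversalEnveloping.{u, v, u} (jordanHom A) where
  generates := toLimit_generates
  factors _ _ φ := exists_lift φ.isJordanMap

end JordanEnvelope

/-! ### Consequences of universality: the antiautomorphism and uniqueness -/

namespace IsUniversalEnveloping

variable {A : Type u} [LocallyJBAlgebra A]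

theorem exists_antiautomorphism {L : Type u} [LocallyCStarAlgebra L] {ψ : JordanHom A L}
    (hψ : IsUniversalEnveloping.{u, u, u} ψ) :
    ∃ Φ : L ≃L[ℂ] L, IsStarAntiautomorphismOfOrderTwo Φ ∧ ∀ a : A, Φ (ψ a) = ψ a := by
  obtain ⟨h, hc, hh⟩ := hψ.factors Lᵐᵒᵖ ψ.isJordanMap.op.toJordanHom
  have hh' : ∀ a, (h (ψ a)).unop = ψ a := fun a => by rw [← hh a]; rfl
  let g : L →⋆ₙₐ[ℂ] L :=
    { toFun := fun x => (h (h x).unop).unop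
      map_smul' := fun c x => by simp
      map_zero' := by simp
      map_add' := fun x y => by simp
      map_mul' := fun x y => by simp
      map_star' := fun x => by simp [map_star] }
  have hcu : Continuous fun x => (h x).unop := MulOpposite.continuous_unop.comp hc
  -- Reversing products twice gives a *-homomorphism, and it fixes the generators.
  have hinv : ∀ x, (h (h x).unop).unop = x := fun x =>
    NonUnitalStarAlgHom.eq_of_generates hψ.generates (f := g) (g := NonUnitalStarAlgHom.id ℂ L)
      (hcu.comp hcu) continuous_id
      (fun a => (congrArg (fun y => (h y).unop) (hh' a)).trans (hh' a)) x
  exact ⟨{ toFun := fun x => (h x).unop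
           invFun := fun x => (h x).unop
           map_add' := fun x y => by simp
           map_smul' := fun c x => by simp
           left_inv := hinv
           right_inv := hinv
           continuous_toFun := hcu
           continuous_invFun := hcu },
    { map_mul := fun x y => congrArg MulOpposite.unop (map_mul h x y)
      map_star := fun x => congrArg MulOpposite.unop (map_star h x)
      involutive := hinv }, hh'⟩

theorem exists_starAlgEquiv {L : Type v} {L' : Type w} [LocallyCStarAlgebra L]
    [LocallyCStarAlgebra L'] {ψ : JordanHom A L} {ψ' : JordanHom A L'}
    (hψ : IsUniversalEnveloping.{u, w, v} ψ) (hψ' : IsUniversalEnveloping.{u, v, w} ψ') :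
    ∃ e : L ≃⋆ₐ[ℂ] L', Continuous e ∧ Continuous e.symm ∧ ∀ a : A, e (ψ a) = ψ' a := by
  obtain ⟨f, hf, hfa⟩ := hψ.factors L' ψ'
  obtain ⟨g, hg, hga⟩ := hψ'.factors L ψ
  exact ⟨{ f with
      invFun := g
      left_inv := NonUnitalStarAlgHom.eq_of_generates hψ.generates (f := g.comp f)
        (g := NonUnitalStarAlgHom.id ℂ L) (hg.comp hf) continuous_id
        (fun a => (congrArg g (hfa a).symm).trans (hga a).symm)
      right_inv := NonUnitalStarAlgHom.eq_of_generates hψ'.generates (f := f.comp g)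
        (g := NonUnitalStarAlgHom.id ℂ L') (hf.comp hg) continuous_id
        (fun a => (congrArg f (hga a).symm).trans (hfa a).symm)
      map_add' := map_add f
      map_mul' := map_mul f
      map_star' := map_star f
      map_smul' := map_smul f }, hf, hg, fun a => (hfa a).symm⟩

end IsUniversalEnveloping

/-- Universality of the limit holds for tests in every universe; it is used at `v` for the claim, at
`u` for the opposite algebra and at `w` for the competitor `L'`. -/
theorem theorem3 (A : Type u) [LocallyJBAlgebra A] :
    ∃ (L : Type u) (_ : LocallyCStarAlgebra L) (ψ : JordanHom A L),
      IsUniversalEnveloping.{u, v, u} ψ ∧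
      (∃ Φ : L ≃L[ℂ] L, IsStarAntiautomorphismOfOrderTwo Φ ∧ ∀ a : A, Φ (ψ a) = ψ a) ∧
      ∀ (L' : Type w) [LocallyCStarAlgebra L'] (ψ' : JordanHom A L'),
        IsUniversalEnveloping.{u, u, w} ψ' →
        ∃ e : L ≃⋆ₐ[ℂ] L', Continuous e ∧ Continuous e.symm ∧ ∀ a : A, e (ψ a) = ψ' a :=
  ⟨(JordanEnvelope.family A).limit, inferInstance, JordanEnvelope.jordanHom A,
    JordanEnvelope.isUniversalEnveloping A,
    (JordanEnvelope.isUniversalEnveloping A).exists_antiautomorphism,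
    fun _ _ _ h => (JordanEnvelope.isUniversalEnveloping A).exists_starAlgEquiv h⟩
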